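/- **Theorem 6.1 (Estimation consistency of SingBoost).** For every sample size $n$ let $p_n\ge 1$, $\beta_n\in\mathbb R^{p_n}$, $f_n(x)=\sum_{j=1}^{p_n}\beta_{n,j}x_j$, and let $$Y_i=f_n(X_i)+\epsilon_i,\qquad i=1,\dots,n,$$ where $X_1,\dots,X_n$ are i.i.d. random vectors in $\mathbb R^{p_n}$ whose coordinates satisfy $\mathbb E[X_{1,j}^2]=1$ for all $j$, the errors $\epsilon_1,\dots,\epsilon_n$ are i.i.d. with mean zero and a law that does not depend on $n$, and $(\epsilon_i)_i$ is independent of $(X_i)_i$. Let $X$ be a new observation, independent of the data, with the law of $X_1$; $\mathbb E_X$ is the expectation over $X$ only, with the data held fixed. *Algorithm.* Write $\langle u,v\rangle_{(n)}=\frac1n\sum_{i=1}^n u_iv_i$ for vectors of values at the observations, and identify a function $g$ on $\mathbb R^{p_n}$ with $(g(X_i))_i$. Let $g_j(x)=x_j/\big(\frac1n\sum_i X_{i,j}^2\big)^{1/2}$ be the baselearner of variable $j$, with $g_j=0$ if the $j$-th column of the data vanishes. Let $\kappa\in(0,1]$ be a step size, $M_n\ge1$ an integer and $\tilde L_n:\mathbb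 R^n\times\mathbb R^n\to\mathbb R$ an arbitrary (empirical) target loss, $\tilde L_n(r,u)$ being the loss of the predictions $u$ for the responses $r$. SingBoost starts with $\hat f_n^{(0)}=0$; in iteration $m\ge1$ it forms the current residuals $r^{(m-1)}=(Y_i-\hat f_n^{(m-1)}(X_i))_i$, selects a variable $\hat j_m$, and sets $$\hat f_n^{(m)}=\hat f_n^{(m-1)}+\kappa\,\langle r^{(m-1)},g_{\hat j_m}\rangle_{(n)}\,g_{\hat j_m}.$$ In the singular iterations $m=1,M_n+1,2M_n+1,\dots$ the variable $\hat j_m$ minimizes $j\mapsto\tilde L_n\big(r^{(m-1)},\langle r^{(m-1)},g_j\rangle_{(n)}\,g_j\big)$; in all other iterations ($L_2$-Boosting) it maximizes $j\mapsto|\langle r^{(m-1)},g_j\rangle_{(n)}|$. Ties are broken arbitrarily. *Assumptions.* - **(E1)** There are $\xi\in(0,1)$ and $C\in(0,\infty)$ such that $p_n=O(\exp(Cn^{1-\xi}))$. - **(E2)** $\sup_n\sum_{j=1}^{p_n}|\beta_{n,j}|<\infty$. - **(E3)** $\sup_{j,n}\|X_{1,j}\|_\infty<\infty$ (essential supremum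 norm). - **(E4)** $\mathbb E[|\epsilon_1|^\delta]<\infty$ for some $\delta>4/\xi$, with $\xi$ from (E1). - **(E5)** (Corr-min condition) There is $a>0$ such that, almost surely, for all $m\ge 1$ and $n$ there is $\tilde C\ge a$ with $$|\langle r^{(m-1)},g_{\hat j_m}\rangle_{(n)}|\ \ge\ \tilde C\,\sup_j|\langle r^{(m-1)},g_j\rangle_{(n)}|.$$ *Conclusion.* If $m_n\to\infty$ sufficiently slowly, then $$\mathbb E_X\big[(\hat f_n^{(m_n)}(X)-f_n(X))^2\big]=o_P(1)\qquad(n\to\infty).$$ That is, there is a sequence $r_n\to\infty$ of natural numbers, depending only on the model, $\kappa$ and $a$ (not on $\tilde L_n$, $M_n$ or the selected variables), such that this holds for every sequence of natural numbers with $m_n\to\infty$ and $m_n\le r_n$ for all large $n$. -/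

import Mathlib

open MeasureTheory ProbabilityTheory Filter Topology Asymptotics

noncomputable section

namespace SingBoost

/-- The linear function `z ↦ ∑ j, b j * z j` on `ℝ^p`. -/
def linPred {p : ℕ} (b z : Fin p → ℝ) : ℝ := ∑ j, b j * z j

/-- Empirical inner product `⟨u, v⟩_(n) = (1/n) ∑ i, u i * v i` of two vectors of values at the
`n` observations. -/
def empInner {n : ℕ} (u v : Fin n → ℝ) : ℝ := (n : ℝ)⁻¹ * ∑ i, u i * v i

/-- Empirical norm `‖x_{·,j}‖_(n)` of the `j`-th column of the design matrix `x`. -/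
def colNorm {n p : ℕ} (x : Fin n → Fin p → ℝ) (j : Fin p) : ℝ :=
  Real.sqrt (empInner (fun i => x i j) (fun i => x i j))

/-- The baselearner `g_j` of the variable `j`: the `j`-th coordinate, scaled so that
`⟨g_j, g_j⟩_(n) = 1`. (If the `j`-th column vanishes at all observations then `g_j = 0`.) -/
def baseLearner {n p : ℕ} (x : Fin n → Fin p → ℝ) (j : Fin p) (z : Fin p → ℝ) : ℝ :=
  z j / colNorm x j

/-- Empirical correlation `⟨r, g_j⟩_(n)` of the residual vector `r` with the variable `j`. -/
def corr {n p : ℕ} (x : Fin n → Fin p → ℝ) (r : Fin n → ℝ) (j : Fin p) : ℝ :=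
  empInner r (fun i => baseLearner x j (x i))

/-- The simple least squares fit of the residual vector `r` on the variable `j` (without
intercept), that is `⟨r, g_j⟩_(n) g_j`, as a function on `ℝ^p`. -/
def lsFit {n p : ℕ} (x : Fin n → Fin p → ℝ) (r : Fin n → ℝ) (j : Fin p) (z : Fin p → ℝ) : ℝ :=
  corr x r j * baseLearner x j z

/-- The model `f̂^(m)` after `m` componentwise least squares boosting iterations with step size `κ`
on the data `(x, y)`, when the variable selected in iteration `k ≥ 1` is `sel k`:
`f̂^(0) = 0`, and `f̂^(m+1)` is `f̂^(m)` plus `κ` times the simple least squares fit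
of the current residuals on the selected variable. -/
def model {n p : ℕ} (κ : ℝ) (x : Fin n → Fin p → ℝ) (y : Fin n → ℝ) (sel : ℕ → Fin p) :
    ℕ → (Fin p → ℝ) → ℝ
  | 0 => fun _ => 0
  | m + 1 => fun z =>
      model κ x y sel m z + κ * lsFit x (fun i => y i - model κ x y sel m (x i)) (sel (m + 1)) z

/-- The residual vector `(y i - f̂^(m)(x i))_i` after `m` iterations. -/
def residual {n p : ℕ} (κ : ℝ) (x : Fin n → Fin p → ℝ) (y : Fin n → ℝ) (sel : ℕ → Fin p)
    (m : ℕ) : Fin n → ℝ :=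
  fun i => y i - model κ x y sel m (x i)

/-- `sel` is a sequence of variables selected by SingBoost with step size `κ`, target loss `L` and
singular iterations `1, M + 1, 2 M + 1, …`. Here `L r u` is the empirical target loss of the
predictions `u` for the responses `r`; it need not be a sum over the observations.
In a singular iteration the variable whose simple least squares fit of the current residuals
has the smallest target loss is selected; every other iteration is an `L₂`-boosting iteration and
selects the variable with the largest absolute correlation with the current residuals.
Ties may be broken in any way. -/
def IsSelection {n p : ℕ} (κ : ℝ) (L : (Fin n → ℝ) → (Fin n → ℝ) → ℝ) (M : ℕ)
    (x : Fin n → Fin p → ℝ) (y : Fin n → ℝ) (sel : ℕ → Fin p) : Prop :=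
  ∀ m : ℕ,
    (M ∣ m → ∀ j : Fin p,
      L (residual κ x y sel m) (fun i => lsFit x (residual κ x y sel m) (sel (m + 1)) (x i)) ≤
        L (residual κ x y sel m) (fun i => lsFit x (residual κ x y sel m) j (x i))) ∧
    (¬ M ∣ m → ∀ j : Fin p,
      |corr x (residual κ x y sel m) j| ≤ |corr x (residual κ x y sel m) (sel (m + 1))|)

/-- The Corr-min inequalities with constant `a` along a run of the algorithm: in every iteration
`m + 1`, the absolute correlation of the selected variable with the current residuals is at least
`Ct ≥ a` times the largest absolute correlation. -/
def CorrMin {n p : ℕ} (κ a : ℝ) (x : Fin n → Fin p → ℝ) (y : Fin n → ℝ)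
    (sel : ℕ → Fin p) : Prop :=
  ∀ m : ℕ, ∃ Ct : ℝ, a ≤ Ct ∧
    Ct * (⨆ j : Fin p, |corr x (residual κ x y sel m) j|) ≤
      |corr x (residual κ x y sel m) (sel (m + 1))|

end SingBoost

end

/-! The population version of the algorithm is a weak greedy algorithm in `L²(P)` with step size
`κ`, and it converges at a rate that depends only on `κ`, `a` and a bound `B` for the `ℓ¹` norm of the
true coefficients. Write `V k` for the squared `L²(P)` distance of the model to the truth, `u k` for
the correlation of the selected variable with the residuals, and `A k` for a bound on the `ℓ¹` norm
of the coefficients of the difference. Up to sampling errors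
* `V (k + 1) ≤ V k - κ / 2 * u k ^ 2`, so `∑ u k ^ 2` is bounded,
* `A (k + 1) ≤ A k + 2 * |u k|`, so `A k = O(√k)` by the Cauchy–Schwarz inequality,
* `V k ≤ A k * max_j |⟨f - f_k, z_j⟩| ≤ A k * (2 / a) * |u k|` by the Corr-min condition.
If `V` stayed above `v > 0`, then `u k ^ 2` would be at least of order `v ^ 2 / k`, and the
divergence of the harmonic series would contradict the first item (`le_rate_of_recursion`).

The sampling errors of `m` iterations are controlled by the uniform deviations between empirical and
population second moments and by the largest empirical correlation between noise and predictors
(`Close`, `Close.step`); if these are at most `tolerance B m`, then the population bound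
`rate κ a B m` holds for the model fitted to the data (`Close.quadForm_le_rate`).

For every fixed tolerance these deviations are small with probability tending to one, by Hoeffding's
inequality and a union bound, since `log (p n) = o(n)` (`tendsto_measure_not_close`). The noise is
truncated at a fixed high level, and Markov's inequality takes care of the remainder. A diagonal
argument (`exists_tendsto_diagonal`) then gives a sequence `r n → ∞` such that the deviations
are within `tolerance B (r n)` with probability tending to one. Since `tolerance B` is antitone, they
are then also within `tolerance B (m n)` whenever `m n ≤ r n`. -/

namespace SingBoost

/-! ### The boosting model as a linear function and one iteration of the algorithm -/

section Deterministic

variable {n p : ℕ}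

/-- The coefficient vector of the boosting model: `model κ x y sel m` is the linear function with
coefficients `coef κ x y sel m` (see `model_eq_linPred`). -/
noncomputable def coef (κ : ℝ) (x : Fin n → Fin p → ℝ) (y : Fin n → ℝ) (sel : ℕ → Fin p) :
    ℕ → Fin p → ℝ
  | 0 => 0
  | m + 1 => coef κ x y sel m + Pi.single (sel (m + 1))
      (κ * corr x (residual κ x y sel m) (sel (m + 1)) / colNorm x (sel (m + 1)))

lemma linPred_add (b c z : Fin p → ℝ) : linPred (b + c) z = linPred b z + linPred c z := by
  simp [linPred, add_mul, Finset.sum_add_distrib]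

lemma linPred_sub (b c z : Fin p → ℝ) : linPred (b - c) z = linPred b z - linPred c z := by
  simp [linPred, sub_mul, Finset.sum_sub_distrib]

lemma linPred_single (j : Fin p) (s : ℝ) (z : Fin p → ℝ) :
    linPred (Pi.single j s) z = s * z j := by
  simp [linPred, Pi.single_apply]

lemma model_eq_linPred (κ : ℝ) (x : Fin n → Fin p → ℝ) (y : Fin n → ℝ) (sel : ℕ → Fin p)
    (m : ℕ) (z : Fin p → ℝ) : model κ x y sel m z = linPred (coef κ x y sel m) z := by
  induction m with
  | zero => simp [model, coef, linPred]
  | succ m ih =>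
    rw [coef, linPred_add, linPred_single, ← ih]
    have h : (fun i => y i - model κ x y sel m (x i)) = residual κ x y sel m := rfl
    simp only [model, lsFit, baseLearner, h]
    ring

/-- The quadratic form of the matrix `G`. For the second moment matrix `G` of `P` it is the squared
`L²(P)` norm of the linear function with coefficients `θ`. -/
def quadForm (G : Fin p → Fin p → ℝ) (θ : Fin p → ℝ) : ℝ := ∑ j, θ j * ∑ k, G j k * θ k

lemma quadForm_sub_single {G : Fin p → Fin p → ℝ} (hsymm : ∀ j k, G j k = G k j)
    (θ : Fin p → ℝ) (j : Fin p) (s : ℝ) :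
    quadForm G (θ - Pi.single j s) =
      quadForm G θ - 2 * s * (∑ k, G j k * θ k) + s ^ 2 * G j j := by
  have h1 : ∀ l, ∑ k, G l k * (θ k - (Pi.single j s : Fin p → ℝ) k) =
      ∑ k, G l k * θ k - G l j * s := by
    intro l
    simp [mul_sub, Finset.sum_sub_distrib, Pi.single_apply]
  simp only [quadForm, Pi.sub_apply, h1]
  simp only [sub_mul, mul_sub, Finset.sum_sub_distrib]
  simp only [Pi.single_apply, ite_mul, zero_mul, Finset.sum_ite_eq', Finset.mem_univ, if_true]
  have h2 : ∑ l, θ l * (G l j * s) = s * ∑ k, G j k * θ k := by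
    rw [Finset.mul_sum]
    exact Finset.sum_congr rfl fun l _ => by rw [hsymm l j]; ring
  rw [h2]
  ring

lemma empInner_linPred_left (θ : Fin p → ℝ) (x : Fin n → Fin p → ℝ) (v : Fin n → ℝ) :
    empInner (fun i => linPred θ (x i)) v = ∑ k, empInner (fun i => x i k) v * θ k := by
  simp only [empInner, linPred, Finset.sum_mul, Finset.mul_sum]
  rw [Finset.sum_comm]
  exact Finset.sum_congr rfl fun k _ => Finset.sum_congr rfl fun i _ => by ring

lemma empInner_add_left (u u' v : Fin n → ℝ) :
    empInner (fun i => u i + u' i) v = empInner u v + empInner u' v := by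
  simp [empInner, add_mul, Finset.sum_add_distrib, mul_add]

lemma corr_eq (x : Fin n → Fin p → ℝ) (r : Fin n → ℝ) (j : Fin p) :
    corr x r j = empInner r (fun i => x i j) / colNorm x j := by
  simp only [corr, empInner, baseLearner, Finset.mul_sum, Finset.sum_div]
  exact Finset.sum_congr rfl fun i _ => by ring

/-- The empirical quantities that enter the algorithm are within `Δ` of their population
counterparts: the empirical second moments of the predictors are close to `G`, and the noise `e` is
almost orthogonal to every predictor. -/
structure Close (G : Fin p → Fin p → ℝ) (x : Fin n → Fin p → ℝ) (e : Fin n → ℝ) (Δ : ℝ) :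
    Prop where
  gram : ∀ j k, |empInner (fun i => x i j) (fun i => x i k) - G j k| ≤ Δ
  noise : ∀ j, |empInner e (fun i => x i j)| ≤ Δ

lemma Close.mono {G : Fin p → Fin p → ℝ} {x : Fin n → Fin p → ℝ} {e : Fin n → ℝ} {Δ Δ' : ℝ}
    (h : Close G x e Δ) (hΔ : Δ ≤ Δ') : Close G x e Δ' :=
  ⟨fun j k => (h.gram j k).trans hΔ, fun j => (h.noise j).trans hΔ⟩

/-- The empirical inner product of the residuals with a predictor is close to its population
counterpart. -/
lemma Close.abs_empInner_sub_le {G : Fin p → Fin p → ℝ} (hsymm : ∀ j k, G j k = G k j)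
    {x : Fin n → Fin p → ℝ} {e : Fin n → ℝ} {Δ : ℝ} (h : Close G x e Δ) (hΔ : 0 ≤ Δ)
    {θ : Fin p → ℝ} {A : ℝ} (hA : ∑ j, |θ j| ≤ A) (j : Fin p) :
    |empInner (fun i => linPred θ (x i) + e i) (fun i => x i j) - ∑ k, G j k * θ k| ≤
      (A + 1) * Δ := by
  rw [empInner_add_left, empInner_linPred_left]
  have h1 : |∑ k, empInner (fun i => x i k) (fun i => x i j) * θ k - ∑ k, G j k * θ k| ≤ A * Δ := by
    rw [← Finset.sum_sub_distrib]
    calc _ ≤ ∑ k, |empInner (fun i => x i k) (fun i => x i j) * θ k - G j k * θ k| :=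
          Finset.abs_sum_le_sum_abs _ _
      _ ≤ ∑ k, |θ k| * Δ := by
          refine Finset.sum_le_sum fun k _ => ?_
          rw [← sub_mul, abs_mul, mul_comm, hsymm j k]
          exact mul_le_mul_of_nonneg_left (h.gram k j) (abs_nonneg _)
      _ ≤ A * Δ := by
          rw [← Finset.sum_mul]
          exact mul_le_mul_of_nonneg_right hA hΔ
  have h2 := h.noise j
  rw [abs_le] at h1 h2 ⊢
  constructor <;> linarith [h1.1, h1.2, h2.1, h2.2]

/-- One boosting iteration. Here `θ` is the vector of true minus current coefficients, `r` the
vector of current residuals and `j` the selected variable. Up to errors of order `Δ`, the squared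
population distance decreases by at least `κ / 2 * corr x r j ^ 2`, and this distance is itself
controlled by `|corr x r j|` and a bound `A` on the `ℓ¹` norm of `θ`. -/
lemma Close.step {G : Fin p → Fin p → ℝ} (hsymm : ∀ j k, G j k = G k j) (hdiag : ∀ j, G j j = 1)
    (hG : ∀ j k, |G j k| ≤ 1) {x : Fin n → Fin p → ℝ} {e : Fin n → ℝ} {Δ : ℝ}
    (h : Close G x e Δ) (hΔ0 : 0 ≤ Δ) (hΔ1 : Δ ≤ 1 / 3)
    {θ : Fin p → ℝ} {A : ℝ} (hA : ∑ j, |θ j| ≤ A) {r : Fin n → ℝ}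
    (hr : ∀ i, r i = linPred θ (x i) + e i) {κ : ℝ} (hκ0 : 0 < κ) (hκ1 : κ ≤ 1) {a : ℝ}
    (ha : 0 < a) {j : Fin p} (hcm : ∀ k, a * |corr x r k| ≤ |corr x r j|) :
    quadForm G (θ - Pi.single j (κ * corr x r j / colNorm x j)) ≤
        quadForm G θ - κ / 2 * corr x r j ^ 2 + 6 * (A + 1) ^ 2 * Δ ∧
      quadForm G θ ≤ A * (2 / a * |corr x r j|) + 6 * (A + 1) ^ 2 * Δ ∧
      |κ * corr x r j / colNorm x j| ≤ 2 * |corr x r j| ∧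
      |corr x r j| ≤ 2 * A + 1 := by
  have hA0 : 0 ≤ A := (Finset.sum_nonneg fun j _ => abs_nonneg (θ j)).trans hA
  have hN2 : ∀ k, colNorm x k ^ 2 = empInner (fun i => x i k) (fun i => x i k) := fun k =>
    Real.sq_sqrt (by
      unfold empInner
      exact mul_nonneg (by positivity) (Finset.sum_nonneg fun i _ => mul_self_nonneg _))
  -- the population norm of every predictor is `1`, so its empirical norm is close to `1`
  have hNlo : ∀ k, 2 / 3 ≤ colNorm x k ^ 2 := fun k => by
    have := (abs_le.1 (h.gram k k)).1
    rw [hdiag, ← hN2] at this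
    linarith
  have hN0 : ∀ k, 0 ≤ colNorm x k := fun k => Real.sqrt_nonneg _
  have hNhi : ∀ k, colNorm x k ≤ 2 := fun k => by
    have := (abs_le.1 (h.gram k k)).2
    rw [hdiag, ← hN2] at this
    nlinarith [hN0 k]
  have hN23 : ∀ k, 2 / 3 ≤ colNorm x k := fun k => by
    by_contra! hlt
    nlinarith [hN0 k, hNlo k]
  have hNpos : ∀ k, 0 < colNorm x k := fun k => by linarith [hN23 k]
  obtain rfl : r = fun i => linPred θ (x i) + e i := funext hr
  set r : Fin n → ℝ := fun i => linPred θ (x i) + e i with hrdef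
  set η := (A + 1) * Δ with hη
  have hη0 : 0 ≤ η := by positivity
  have hclose : ∀ k, |colNorm x k * corr x r k - ∑ l, G k l * θ l| ≤ η := fun k => by
    have := h.abs_empInner_sub_le hsymm hΔ0 hA k
    rwa [corr_eq, mul_div_cancel₀ _ (hNpos k).ne']
  have hc : ∀ k, |∑ l, G k l * θ l| ≤ A := fun k =>
    calc _ ≤ ∑ l, |G k l * θ l| := Finset.abs_sum_le_sum_abs _ _
      _ ≤ ∑ l, |θ l| := Finset.sum_le_sum fun l _ => by
          rw [abs_mul]
          exact mul_le_of_le_one_left (abs_nonneg _) (hG k l)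
      _ ≤ A := hA
  have hu : |corr x r j| ≤ 2 * A + 1 := by
    have h1 : |colNorm x j * corr x r j| ≤ A + η := by
      have := hclose j; have := hc j
      rw [abs_le] at *
      constructor <;> linarith
    rw [abs_mul, abs_of_pos (hNpos j)] at h1
    nlinarith [hN23 j, abs_nonneg (corr x r j)]
  refine ⟨?_, ?_, ?_, hu⟩
  · rw [quadForm_sub_single hsymm, hdiag]
    set u := corr x r j
    set N := colNorm x j
    set c := ∑ l, G j l * θ l
    have hcu := hclose j
    have hNp : 0 < N := hNpos j
    -- `c = N * u` up to `η`, so the cross term is `2 * κ * u ^ 2` up to an error of order `η`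
    have e1 : 2 * (κ * u / N) * c = 2 * κ * u ^ 2 - 2 * κ * (u * (N * u - c)) / N := by
      field_simp
      ring
    have e2 : (κ * u / N) ^ 2 ≤ κ * (3 / 2 * u ^ 2) := by
      rw [div_pow, div_le_iff₀ (by positivity)]
      have : 2 / 3 ≤ N ^ 2 := hNlo j
      have h3 : κ ^ 2 ≤ κ := by nlinarith
      have h4 : κ ^ 2 * u ^ 2 ≤ κ * u ^ 2 := mul_le_mul_of_nonneg_right h3 (sq_nonneg u)
      have h5 : 0 ≤ κ * u ^ 2 := by positivity
      nlinarith
    have e3 : 2 * κ * (u * (N * u - c)) / N ≤ 6 * (A + 1) ^ 2 * Δ := by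
      have h3 : u * (N * u - c) ≤ 2 * (A + 1) * η := by
        calc _ ≤ |u * (N * u - c)| := le_abs_self _
          _ = |u| * |N * u - c| := abs_mul _ _
          _ ≤ (2 * A + 1) * η := mul_le_mul hu hcu (abs_nonneg _) (by positivity)
          _ ≤ _ := by nlinarith
      rw [div_le_iff₀ hNp]
      have h4 : 2 * κ * (u * (N * u - c)) ≤ 2 * κ * (2 * (A + 1) * η) :=
        mul_le_mul_of_nonneg_left h3 (by positivity)
      have h5 : 2 * κ * (2 * (A + 1) * η) ≤ 2 * 1 * (2 * (A + 1) * η) := by gcongr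
      have h6 : 6 * (A + 1) ^ 2 * Δ * (2 / 3) ≤ 6 * (A + 1) ^ 2 * Δ * N := by
        gcongr
        exact hN23 j
      rw [hη] at h5 h4
      nlinarith
    linarith
  · have h1 : ∀ k, |∑ l, G k l * θ l| ≤ 2 / a * |corr x r j| + η := fun k => by
      have h2 : |corr x r k| ≤ |corr x r j| / a := by
        rw [le_div_iff₀ ha, mul_comm]; exact hcm k
      have h3 : |colNorm x k * corr x r k| ≤ 2 * (|corr x r j| / a) := by
        rw [abs_mul, abs_of_pos (hNpos k)]
        exact mul_le_mul (hNhi k) h2 (abs_nonneg _) (by norm_num)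
      have h4 := hclose k
      have h5 : 2 / a * |corr x r j| = 2 * (|corr x r j| / a) := by ring
      rw [h5]
      rw [abs_le] at h3 h4 ⊢
      constructor <;> linarith [h3.1, h3.2, h4.1, h4.2]
    have h0 : 0 ≤ 2 / a * |corr x r j| + η := by positivity
    calc quadForm G θ ≤ ∑ k, |θ k| * (2 / a * |corr x r j| + η) := by
          refine Finset.sum_le_sum fun k _ => ?_
          refine (le_abs_self _).trans ?_
          rw [abs_mul]
          exact mul_le_mul_of_nonneg_left (h1 k) (abs_nonneg _)
      _ ≤ A * (2 / a * |corr x r j| + η) := by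
          rw [← Finset.sum_mul]
          exact mul_le_mul_of_nonneg_right hA h0
      _ ≤ _ := by
          have : A * η ≤ 6 * (A + 1) ^ 2 * Δ := by
            rw [hη, ← mul_assoc]
            exact mul_le_mul_of_nonneg_right (by nlinarith) hΔ0
          linarith
  · rw [abs_div, abs_mul, abs_of_pos hκ0, abs_of_pos (hNpos j), div_le_iff₀ (hNpos j)]
    nlinarith [hN23 j, abs_nonneg (corr x r j), mul_le_of_le_one_left (abs_nonneg (corr x r j)) hκ1]

end Deterministic

/-! ### Convergence of the greedy recursion -/

/-- The bound on the squared population distance after `m` iterations that holds up to sampling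
errors below `tolerance B m`. It tends to zero because the harmonic series diverges. -/
noncomputable def rate (κ a B : ℝ) (m : ℕ) : ℝ :=
  1 / ((m : ℝ) + 1) +
    √((2 / a) ^ 2 * (B + 2 * √(2 / κ * (B ^ 2 + 1))) ^ 2 * (2 / κ * (B ^ 2 + 1)) /
      ∑ k ∈ Finset.range m, (1 / ((k : ℝ) + 1)))

lemma tendsto_rate (κ a B : ℝ) : Tendsto (rate κ a B) atTop (𝓝 0) := by
  have h1 : Tendsto (fun m : ℕ => 1 / ((m : ℝ) + 1)) atTop (𝓝 0) :=
    tendsto_one_div_add_atTop_nhds_zero_nat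
  have h2 := (Real.tendsto_sum_range_one_div_nat_succ_atTop.const_div_atTop
    ((2 / a) ^ 2 * (B + 2 * √(2 / κ * (B ^ 2 + 1))) ^ 2 * (2 / κ * (B ^ 2 + 1)))).sqrt
  have h3 := h1.add h2
  rwa [Real.sqrt_zero, add_zero] at h3

/-- The sampling error under which `m` iterations of the algorithm follow the population
version. The factor `5 ^ m` dominates the growth of the `ℓ¹` norms of the coefficients. -/
noncomputable def tolerance (B : ℝ) (m : ℕ) : ℝ :=
  1 / (6 * ((B + 1) * 5 ^ m) ^ 2 * ((m : ℝ) + 1) ^ 2)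

lemma tolerance_pos {B : ℝ} (hB : 0 ≤ B) (m : ℕ) : 0 < tolerance B m := by
  unfold tolerance; positivity

lemma tolerance_antitone {B : ℝ} (hB : 0 ≤ B) : Antitone (tolerance B) := by
  intro m m' h
  unfold tolerance
  have : (m : ℝ) ≤ m' := by exact_mod_cast h
  gcongr
  norm_num

lemma tolerance_le {B : ℝ} (hB : 0 ≤ B) (m : ℕ) : tolerance B m ≤ 1 / 3 := by
  refine (tolerance_antitone hB (Nat.zero_le m)).trans ?_
  unfold tolerance
  rw [div_le_iff₀ (by positivity)]
  norm_num
  nlinarith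

/-- Convergence of the greedy recursion. The increments `u k` are square summable by the energy
decrease, so the `ℓ¹` bounds `A k` grow at most like `√k`; then the second inequality forces
`u k ^ 2` to be at least of order `V m ^ 2 / k`, and the harmonic series diverges. -/
lemma le_rate_of_recursion {V A u : ℕ → ℝ} {κ a B E : ℝ} (hκ : 0 < κ) (ha : 0 < a) (hB : 0 ≤ B)
    {m : ℕ} (hm : 1 ≤ m) (hE0 : 0 ≤ E) (hE : E ≤ 1 / ((m : ℝ) + 1) ^ 2) (hV0 : V 0 ≤ B ^ 2)
    (hVm : 0 ≤ V m) (hA : ∀ k, A k = B + ∑ i ∈ Finset.range k, 2 * |u i|)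
    (hdec : ∀ k < m, V (k + 1) ≤ V k - κ / 2 * u k ^ 2 + E)
    (hub : ∀ k < m, V k ≤ A k * (2 / a * |u k|) + E) :
    V m ≤ rate κ a B m := by
  set S := 2 / κ * (B ^ 2 + 1) with hS
  have hS0 : 0 ≤ S := by positivity
  have hmE : ((m : ℝ) + 1) * E ≤ 1 / ((m : ℝ) + 1) := by
    calc _ ≤ ((m : ℝ) + 1) * (1 / ((m : ℝ) + 1) ^ 2) := by gcongr
      _ = _ := by field_simp
  have hmE1 : (m : ℝ) * E ≤ 1 := by
    have : 1 / ((m : ℝ) + 1) ≤ 1 := by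
      rw [div_le_one (by positivity)]; linarith [(Nat.cast_nonneg m : (0 : ℝ) ≤ m)]
    linarith
  have hsum : ∀ k ≤ m, V k + κ / 2 * ∑ i ∈ Finset.range k, u i ^ 2 ≤ V 0 + k * E := by
    intro k
    induction k with
    | zero => simp
    | succ k ih =>
      intro hk
      have h1 := ih (by omega)
      have h2 := hdec k (by omega)
      rw [Finset.sum_range_succ]
      push_cast
      linarith
  have hsq : ∑ i ∈ Finset.range m, u i ^ 2 ≤ S := by
    have h1 := hsum m le_rfl
    rw [hS, div_mul_eq_mul_div, le_div_iff₀ hκ]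
    linarith
  -- `V` is nonincreasing up to errors, so a bound at one earlier index carries over to `m`
  have hdrop : ∀ k ≤ m, V m ≤ V k + (m - k : ℝ) * E := by
    intro k hk
    have h1 : ∀ d, k + d ≤ m → V (k + d) ≤ V k + d * E := by
      intro d
      induction d with
      | zero => simp
      | succ d ih =>
        intro hd
        have h2 := ih (by omega)
        have h3 := hdec (k + d) (by omega)
        have h4 : 0 ≤ κ / 2 * u (k + d) ^ 2 := by positivity
        rw [← add_assoc]
        push_cast
        linarith
    have h2 := h1 (m - k) (by omega)
    rwa [Nat.add_sub_cancel' hk, Nat.cast_sub hk] at h2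
  -- Cauchy–Schwarz: `A k` grows at most like the square root of `k`
  have hAk : ∀ k < m, A k ^ 2 ≤ (B + 2 * √S) ^ 2 * ((k : ℝ) + 1) := by
    intro k hk
    have h1 : (∑ i ∈ Finset.range k, |u i|) ^ 2 ≤ k * S := by
      calc _ ≤ (Finset.range k).card * ∑ i ∈ Finset.range k, |u i| ^ 2 := sq_sum_le_card_mul_sum_sq
        _ ≤ k * S := by
          simp only [sq_abs, Finset.card_range]
          refine mul_le_mul_of_nonneg_left (le_trans ?_ hsq) (Nat.cast_nonneg k)
          exact Finset.sum_le_sum_of_subset_of_nonneg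
            (Finset.range_subset_range.2 hk.le) fun i _ _ => sq_nonneg _
    have h2 : ∑ i ∈ Finset.range k, |u i| ≤ √((k : ℝ) + 1) * √S := by
      rw [← Real.sqrt_mul (by positivity)]
      refine Real.le_sqrt_of_sq_le (h1.trans ?_)
      nlinarith
    have h3 : A k ≤ (B + 2 * √S) * √((k : ℝ) + 1) := by
      have h4 : 1 ≤ √((k : ℝ) + 1) := by
        rw [Real.one_le_sqrt]; linarith [(Nat.cast_nonneg k : (0 : ℝ) ≤ k)]
      rw [hA, ← Finset.mul_sum]
      nlinarith
    have h0 : 0 ≤ A k := by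
      rw [hA]
      exact add_nonneg hB (Finset.sum_nonneg fun i _ => by positivity)
    calc A k ^ 2 ≤ ((B + 2 * √S) * √((k : ℝ) + 1)) ^ 2 := by gcongr
      _ = _ := by rw [mul_pow, Real.sq_sqrt (by positivity)]
  set w := V m - (m + 1) * E with hw
  have hwle : w ≤ √((2 / a) ^ 2 * (B + 2 * √S) ^ 2 * S /
      ∑ k ∈ Finset.range m, (1 / ((k : ℝ) + 1))) := by
    rcases le_or_gt w 0 with h0 | h0
    · exact h0.trans (Real.sqrt_nonneg _)
    have hH : 0 < ∑ k ∈ Finset.range m, (1 / ((k : ℝ) + 1)) :=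
      Finset.sum_pos (fun k _ => by positivity) ⟨0, Finset.mem_range.2 hm⟩
    refine Real.le_sqrt_of_sq_le ?_
    rw [le_div_iff₀ hH, Finset.mul_sum]
    calc _ ≤ ∑ k ∈ Finset.range m, (2 / a) ^ 2 * (B + 2 * √S) ^ 2 * u k ^ 2 := by
          refine Finset.sum_le_sum fun k hk => ?_
          have hk := Finset.mem_range.1 hk
          have h1 : w ≤ A k * (2 / a * |u k|) := by
            have h2 := hdrop k hk.le
            have h3 := hub k hk
            have h4 : (m - k : ℝ) * E ≤ m * E := by
              have : (0 : ℝ) ≤ k * E := by positivity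
              nlinarith
            rw [hw]
            linarith
          have h2 : w ^ 2 ≤ A k ^ 2 * ((2 / a) ^ 2 * u k ^ 2) := by
            calc w ^ 2 ≤ (A k * (2 / a * |u k|)) ^ 2 := by gcongr
              _ = _ := by rw [mul_pow, mul_pow, sq_abs]
          rw [mul_one_div, div_le_iff₀ (by positivity)]
          calc w ^ 2 ≤ A k ^ 2 * ((2 / a) ^ 2 * u k ^ 2) := h2
            _ ≤ ((B + 2 * √S) ^ 2 * ((k : ℝ) + 1)) * ((2 / a) ^ 2 * u k ^ 2) := by
              gcongr
              exact hAk k hk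
            _ = _ := by ring
      _ ≤ _ := by
          rw [← Finset.mul_sum]
          exact mul_le_mul_of_nonneg_left hsq (by positivity)
  calc V m = (m + 1) * E + w := by rw [hw]; ring
    _ ≤ _ := by rw [rate]; exact add_le_add hmE hwle

/-- If the sampling error is at most `tolerance B m`, then the model after `m` iterations is close
to the true regression function, at a rate that depends on `κ`, `a` and the bound `B` on the
`ℓ¹` norm of the true coefficients only. -/
theorem Close.quadForm_le_rate {n p : ℕ} {G : Fin p → Fin p → ℝ} (hsymm : ∀ j k, G j k = G k j)
    (hdiag : ∀ j, G j j = 1) (hG : ∀ j k, |G j k| ≤ 1) (hpos : ∀ θ, 0 ≤ quadForm G θ)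
    {x : Fin n → Fin p → ℝ} {e y : Fin n → ℝ} {b : Fin p → ℝ}
    (hy : ∀ i, y i = linPred b (x i) + e i) {B : ℝ} (hb : ∑ j, |b j| ≤ B) {κ : ℝ} (hκ0 : 0 < κ)
    (hκ1 : κ ≤ 1) {a : ℝ} (ha : 0 < a) {sel : ℕ → Fin p} (hcm : CorrMin κ a x y sel)
    {m : ℕ} (hm : 1 ≤ m) (h : Close G x e (tolerance B m)) :
    quadForm G (b - coef κ x y sel m) ≤ rate κ a B m := by
  have hB : 0 ≤ B := (Finset.sum_nonneg fun j _ => abs_nonneg (b j)).trans hb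
  set u : ℕ → ℝ := fun k => corr x (residual κ x y sel k) (sel (k + 1)) with hu
  set A : ℕ → ℝ := fun k => B + ∑ i ∈ Finset.range k, 2 * |u i| with hA
  have hr : ∀ k i, residual κ x y sel k i = linPred (b - coef κ x y sel k) (x i) + e i := by
    intro k i
    rw [residual, hy, model_eq_linPred, linPred_sub]
    ring
  have hcm' : ∀ k j, a * |corr x (residual κ x y sel k) j| ≤ |u k| := by
    intro k j
    obtain ⟨Ct, hCt, hle⟩ := hcm k
    have h1 : |corr x (residual κ x y sel k) j| ≤ ⨆ j, |corr x (residual κ x y sel k) j| :=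
      le_ciSup (f := fun j => |corr x (residual κ x y sel k) j|) (Set.finite_range _).bddAbove j
    exact (mul_le_mul hCt h1 (abs_nonneg _) (ha.le.trans hCt)).trans hle
  have hcoef : ∀ k, b - coef κ x y sel (k + 1) =
      b - coef κ x y sel k - Pi.single (sel (k + 1)) (κ * u k / colNorm x (sel (k + 1))) := by
    intro k
    rw [coef, sub_sub]
  have htol := tolerance_pos hB m
  have hstep : ∀ k, ∑ j, |(b - coef κ x y sel k) j| ≤ A k → _ := fun k hk =>
    h.step hsymm hdiag hG htol.le (tolerance_le hB m) hk (hr k) hκ0 hκ1 ha (hcm' k)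
  have hl1 : ∀ k, ∑ j, |(b - coef κ x y sel k) j| ≤ A k := by
    intro k
    induction k with
    | zero => simpa [coef, hA] using hb
    | succ k ih =>
      have h1 := (hstep k ih).2.2.1
      have h2 : A (k + 1) = A k + 2 * |u k| := by
        simp only [hA, Finset.sum_range_succ, add_assoc]
      rw [hcoef, h2]
      set s := κ * u k / colNorm x (sel (k + 1))
      calc _ ≤ ∑ j, (|(b - coef κ x y sel k) j| + |(Pi.single (sel (k + 1)) s : Fin p → ℝ) j|) :=
            Finset.sum_le_sum fun j _ => abs_sub _ _
        _ = ∑ j, |(b - coef κ x y sel k) j| + |s| := by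
            rw [Finset.sum_add_distrib]
            congr 1
            simp [Pi.single_apply, apply_ite abs]
        _ ≤ _ := add_le_add ih h1
  -- a crude exponential bound, used for the size of the sampling errors only
  have hgrow : ∀ k, A k + 1 ≤ (B + 1) * 5 ^ k := by
    intro k
    induction k with
    | zero => simp [hA]
    | succ k ih =>
      have h1 := (hstep k (hl1 k)).2.2.2
      have h2 : A (k + 1) = A k + 2 * |u k| := by
        simp only [hA, Finset.sum_range_succ, add_assoc]
      rw [h2, pow_succ]
      change |u k| ≤ _ at h1
      linarith
  have hA0 : ∀ k, 0 ≤ A k := fun k =>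
    add_nonneg hB (Finset.sum_nonneg fun i _ => by positivity)
  have herr : ∀ k < m, 6 * (A k + 1) ^ 2 * tolerance B m ≤ 1 / ((m : ℝ) + 1) ^ 2 := by
    intro k hk
    have h1 : A k + 1 ≤ (B + 1) * 5 ^ m :=
      (hgrow k).trans (by gcongr; norm_num)
    calc _ ≤ 6 * ((B + 1) * 5 ^ m) ^ 2 * tolerance B m := by
          have := hA0 k
          gcongr
      _ = _ := by
          unfold tolerance
          field_simp
  refine le_rate_of_recursion (V := fun k => quadForm G (b - coef κ x y sel k)) (A := A) (u := u)
    hκ0 ha hB hm (by positivity) le_rfl ?_ (hpos _) (fun k => rfl) ?_ ?_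
  · simp only [coef, sub_zero, quadForm]
    have h1 : ∀ j, |∑ k, G j k * b k| ≤ B := fun j =>
      calc _ ≤ ∑ l, |G j l * b l| := Finset.abs_sum_le_sum_abs _ _
        _ ≤ ∑ l, |b l| := Finset.sum_le_sum fun l _ => by
            rw [abs_mul]
            exact mul_le_of_le_one_left (abs_nonneg _) (hG j l)
        _ ≤ B := hb
    calc _ ≤ ∑ j, |b j| * B := Finset.sum_le_sum fun j _ => by
          refine (le_abs_self _).trans ?_
          rw [abs_mul]
          exact mul_le_mul_of_nonneg_left (h1 j) (abs_nonneg _)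
      _ ≤ B ^ 2 := by
          rw [← Finset.sum_mul, sq]
          exact mul_le_mul_of_nonneg_right hb hB
  · intro k hk
    have h1 := (hstep k (hl1 k)).1
    have h2 := herr k hk
    simp only [hcoef k]
    change _ ≤ quadForm G _ - κ / 2 * u k ^ 2 + _ at h1
    linarith
  · intro k hk
    have h1 := (hstep k (hl1 k)).2.1
    have h2 := herr k hk
    change _ ≤ A k * (2 / a * |u k|) + _ at h1
    linarith

/-! ### Concentration of second moments and noise correlations -/

lemma ae_abs_le_of_hasLaw {Ω : Type*} [MeasurableSpace Ω] {μ : Measure Ω} {n p : ℕ}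
    {P : Measure (Fin p → ℝ)} {X : Fin n → Ω → Fin p → ℝ} (hX : ∀ i, HasLaw (X i) P μ) {K : ℝ}
    (hK : ∀ j, ∀ᵐ z ∂P, |z j| ≤ K) (i : Fin n) (j : Fin p) : ∀ᵐ ω ∂μ, |X i ω j| ≤ K := by
  have h := hK j
  rw [← (hX i).map_eq] at h
  exact ae_of_ae_map (hX i).aemeasurable h

/-- Truncation of the identity at level `T`. -/
noncomputable def trunc (T e : ℝ) : ℝ := if |e| ≤ T then e else 0

lemma measurable_trunc (T : ℝ) : Measurable (trunc T) :=
  Measurable.ite (measurableSet_le (by fun_prop) (by fun_prop)) measurable_id measurable_const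

lemma abs_trunc_le {T : ℝ} (hT : 0 ≤ T) (e : ℝ) : |trunc T e| ≤ T := by
  unfold trunc
  split_ifs with h <;> simp [h, hT]

lemma abs_sub_trunc_le (T e : ℝ) : |e - trunc T e| ≤ |e| := by
  unfold trunc
  split_ifs with h <;> simp

lemma integrable_abs_sub_trunc {Q : Measure ℝ} (hQ : Integrable (fun e : ℝ => e) Q) (T : ℝ) :
    Integrable (fun e => |e - trunc T e|) Q :=
  hQ.abs.mono (by have := measurable_trunc T; fun_prop) (.of_forall fun e => by
    simpa using abs_sub_trunc_le T e)

lemma tendsto_integral_abs_sub_trunc {Q : Measure ℝ} (hQ : Integrable (fun e : ℝ => e) Q) :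
    Tendsto (fun T : ℕ => ∫ e, |e - trunc T e| ∂Q) atTop (𝓝 0) := by
  rw [← integral_zero ℝ ℝ (μ := Q)]
  refine tendsto_integral_of_dominated_convergence (fun e => |e|)
    (fun T => (integrable_abs_sub_trunc hQ T).aestronglyMeasurable) hQ.abs
    (fun T => .of_forall fun e => by simpa using abs_sub_trunc_le T e) (.of_forall fun e => ?_)
  refine tendsto_const_nhds.congr' ?_
  filter_upwards [eventually_ge_atTop ⌈|e|⌉₊] with T hT
  have : |e| ≤ T := (Nat.le_ceil _).trans (by exact_mod_cast hT)
  simp [trunc, this]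

section Concentration

variable {Ω : Type*} [MeasurableSpace Ω] {μ : Measure Ω} [IsProbabilityMeasure μ] {n : ℕ}

lemma measureReal_le_avg_sub_le {Z : Fin n → Ω → ℝ} (hind : iIndepFun Z μ)
    (hmeas : ∀ i, AEMeasurable (Z i) μ) {R c t : ℝ} (hR : 0 < R)
    (hb : ∀ i, ∀ᵐ ω ∂μ, |Z i ω| ≤ R) (hc : ∀ i, ∫ ω, Z i ω ∂μ = c) (ht : 0 ≤ t) (hn : 0 < n) :
    μ.real {ω | t ≤ (n : ℝ)⁻¹ * ∑ i, Z i ω - c} ≤ Real.exp (-(t ^ 2 / (2 * R ^ 2) * n)) := by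
  have hn' : (0 : ℝ) < n := by exact_mod_cast hn
  have hsub : ∀ i, HasSubgaussianMGF (fun ω => Z i ω - c) ((‖R - -R‖₊ / 2) ^ 2) μ := by
    intro i
    have := hasSubgaussianMGF_of_mem_Icc (hmeas i) (a := -R) (b := R)
      ((hb i).mono fun ω h => abs_le.1 h)
    rwa [hc i] at this
  have hind' : iIndepFun (fun i ω => Z i ω - c) μ :=
    hind.comp (fun _ z => z - c) fun _ => by fun_prop
  have h := HasSubgaussianMGF.measure_sum_ge_le_of_iIndepFun hind' (s := Finset.univ)
    (fun i _ => hsub i) (ε := n * t) (by positivity)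
  have hset : {ω | t ≤ (n : ℝ)⁻¹ * ∑ i, Z i ω - c} = {ω | n * t ≤ ∑ i, (Z i ω - c)} := by
    ext ω
    simp only [Set.mem_ofPred_eq, Finset.sum_sub_distrib, Finset.sum_const, Finset.card_univ,
      Fintype.card_fin, nsmul_eq_mul]
    rw [le_sub_iff_add_le, ← div_eq_inv_mul, le_div_iff₀ hn', le_sub_iff_add_le]
    constructor <;> intro h <;> linarith
  rw [hset]
  refine h.trans (le_of_eq ?_)
  have hnorm : ‖R - -R‖ = 2 * R := by
    rw [sub_neg_eq_add, ← two_mul, Real.norm_eq_abs, abs_of_pos (by positivity)]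
  congr 1
  push_cast
  simp only [hnorm, Finset.sum_const, Finset.card_univ, Fintype.card_fin, nsmul_eq_mul]
  field_simp

/-- Hoeffding's inequality for the average of bounded independent random variables with common
mean. -/
lemma measureReal_le_abs_avg_sub_le {Z : Fin n → Ω → ℝ} (hind : iIndepFun Z μ)
    (hmeas : ∀ i, AEMeasurable (Z i) μ) {R c t : ℝ} (hR : 0 < R)
    (hb : ∀ i, ∀ᵐ ω ∂μ, |Z i ω| ≤ R) (hc : ∀ i, ∫ ω, Z i ω ∂μ = c) (ht : 0 ≤ t) (hn : 0 < n) :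
    μ.real {ω | t ≤ |(n : ℝ)⁻¹ * ∑ i, Z i ω - c|} ≤
      2 * Real.exp (-(t ^ 2 / (2 * R ^ 2) * n)) := by
  have h1 := measureReal_le_avg_sub_le hind hmeas hR hb hc ht hn
  have h2 := measureReal_le_avg_sub_le (Z := fun i ω => -Z i ω) (c := -c)
    (hind.comp (fun _ z => -z) fun _ => by fun_prop) (fun i => (hmeas i).neg) hR
    (by simpa using hb) (fun i => by rw [integral_neg, hc i]) ht hn
  have hset : {ω | t ≤ |(n : ℝ)⁻¹ * ∑ i, Z i ω - c|} ⊆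
      {ω | t ≤ (n : ℝ)⁻¹ * ∑ i, Z i ω - c} ∪ {ω | t ≤ (n : ℝ)⁻¹ * ∑ i, -Z i ω - -c} := by
    intro ω hω
    rw [Set.mem_ofPred_eq] at hω
    rcases le_abs.1 hω with h | h
    · exact Or.inl h
    · refine Or.inr ?_
      simp only [Set.mem_ofPred_eq, Finset.sum_neg_distrib, mul_neg]
      linarith
  calc _ ≤ _ := measureReal_mono hset
    _ ≤ _ := measureReal_union_le _ _
    _ ≤ _ := by linarith

/-- If `X` and `ε` are two independent i.i.d. samples, then the pairs `(X i, ε i)` are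
independent. -/
lemma iIndepFun_prodMk_of_indepFun {α β : Type*} [MeasurableSpace α] [MeasurableSpace β]
    {P : Measure α} {Q : Measure β} [IsProbabilityMeasure P] [IsProbabilityMeasure Q]
    {X : Fin n → Ω → α} {ε : Fin n → Ω → β} (hX : ∀ i, HasLaw (X i) P μ) (hXi : iIndepFun X μ)
    (hε : ∀ i, HasLaw (ε i) Q μ) (hεi : iIndepFun ε μ)
    (hXε : IndepFun (fun ω i => X i ω) (fun ω i => ε i ω) μ) :
    iIndepFun (fun i ω => (X i ω, ε i ω)) μ := by
  have hpair : ∀ i, HasLaw (fun ω => (X i ω, ε i ω)) (P.prod Q) μ := fun i =>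
    (hXε.comp (measurable_pi_apply i) (measurable_pi_apply i)).hasLaw_prod (hX i) (hε i)
  rw [iIndepFun_iff_hasLaw_pi_pi hpair]
  have h1 := hXε.hasLaw_prod (hXi.hasLaw_pi hX) (hεi.hasLaw_pi hε)
  have h2 := (measurePreserving_arrowProdEquivProdArrow α β (Fin n) (fun _ => P) (fun _ => Q)).symm
  exact h2.fun_comp_hasLaw h1

section Design

variable {p : ℕ} {P : Measure (Fin p → ℝ)} {X : Fin n → Ω → Fin p → ℝ}

/-- Uncentered second moments `∫ z_j z_k dP`. -/
noncomputable def secondMoment (P : Measure (Fin p → ℝ)) (j k : Fin p) : ℝ := ∫ z, z j * z k ∂P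

lemma integrable_mul_of_bounded [IsProbabilityMeasure P] {K : ℝ}
    (hK : ∀ j, ∀ᵐ z ∂P, |z j| ≤ K) (j k : Fin p) :
    Integrable (fun z : Fin p → ℝ => z j * z k) P := by
  refine Integrable.of_bound (by fun_prop) (K * K) ?_
  filter_upwards [hK j, hK k] with z h1 h2
  rw [Real.norm_eq_abs, abs_mul]
  exact mul_le_mul h1 h2 (abs_nonneg _) ((abs_nonneg _).trans h1)

lemma secondMoment_comm (P : Measure (Fin p → ℝ)) (j k : Fin p) :
    secondMoment P j k = secondMoment P k j := by
  simp only [secondMoment, mul_comm]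

lemma abs_secondMoment_le_one [IsProbabilityMeasure P] {K : ℝ} (hK : ∀ j, ∀ᵐ z ∂P, |z j| ≤ K)
    (hsq : ∀ j, ∫ z, (z j) ^ 2 ∂P = 1) (j k : Fin p) : |secondMoment P j k| ≤ 1 := by
  have hi : ∀ j, Integrable (fun z : Fin p → ℝ => (z j) ^ 2) P := fun j => by
    simpa [sq] using integrable_mul_of_bounded hK j j
  calc |secondMoment P j k| ≤ ∫ z, |z j * z k| ∂P := abs_integral_le_integral_abs
    _ ≤ ∫ z, ((z j) ^ 2 + (z k) ^ 2) / 2 ∂P := by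
        refine integral_mono (integrable_mul_of_bounded hK j k).abs
          (((hi j).add (hi k)).div_const 2) fun z => ?_
        rw [abs_mul, ← sq_abs (z j), ← sq_abs (z k)]
        nlinarith [sq_nonneg (|z j| - |z k|)]
    _ = 1 := by
        rw [integral_div, integral_add (hi j) (hi k), hsq, hsq]
        norm_num

lemma integral_linPred_sq [IsProbabilityMeasure P] {K : ℝ}
    (hK : ∀ j, ∀ᵐ z ∂P, |z j| ≤ K) (θ : Fin p → ℝ) :
    ∫ z, linPred θ z ^ 2 ∂P = quadForm (secondMoment P) θ := by
  have h1 : ∀ z, linPred θ z ^ 2 = ∑ j, ∑ k, θ j * θ k * (z j * z k) := fun z => by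
    rw [sq, linPred, Finset.sum_mul_sum]
    exact Finset.sum_congr rfl fun j _ => Finset.sum_congr rfl fun k _ => by ring
  simp_rw [h1]
  rw [integral_finsetSum _ fun j _ => integrable_finsetSum _ fun k _ =>
    (integrable_mul_of_bounded hK j k).const_mul _]
  refine Finset.sum_congr rfl fun j _ => ?_
  rw [integral_finsetSum _ fun k _ => (integrable_mul_of_bounded hK j k).const_mul _,
    Finset.mul_sum]
  refine Finset.sum_congr rfl fun k _ => ?_
  rw [integral_const_mul, secondMoment]
  ring

/-- Hoeffding's inequality and a union bound over all pairs of predictors. -/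
lemma measureReal_exists_gram_le (hX : ∀ i, HasLaw (X i) P μ) (hXi : iIndepFun X μ) {K : ℝ}
    (hK0 : 0 < K) (hK : ∀ j, ∀ᵐ z ∂P, |z j| ≤ K) {t : ℝ} (ht : 0 ≤ t) (hn : 0 < n) :
    μ.real {ω | ∃ j k, t < |empInner (fun i => X i ω j) (fun i => X i ω k) - secondMoment P j k|} ≤
      2 * ((p : ℝ) ^ 2 * Real.exp (-(t ^ 2 / (2 * (K * K) ^ 2) * n))) := by
  have hone : ∀ q : Fin p × Fin p, μ.real {ω | t ≤ |(n : ℝ)⁻¹ * ∑ i, X i ω q.1 * X i ω q.2 -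
      secondMoment P q.1 q.2|} ≤ 2 * Real.exp (-(t ^ 2 / (2 * (K * K) ^ 2) * n)) := by
    rintro ⟨j, k⟩
    have hg : Measurable (fun z : Fin p → ℝ => z j * z k) := by fun_prop
    refine measureReal_le_abs_avg_sub_le (Z := fun i ω => X i ω j * X i ω k)
      (hXi.comp (fun _ z => z j * z k) fun _ => hg)
      (fun i => hg.comp_aemeasurable (hX i).aemeasurable) (by positivity) (fun i => ?_)
      (fun i => ?_) ht hn
    · filter_upwards [ae_abs_le_of_hasLaw hX hK i j, ae_abs_le_of_hasLaw hX hK i k] with ω h1 h2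
      rw [abs_mul]
      exact mul_le_mul h1 h2 (abs_nonneg _) hK0.le
    · exact (hX i).integral_comp hg.aestronglyMeasurable
  calc _ ≤ μ.real (⋃ q : Fin p × Fin p, {ω | t ≤ |(n : ℝ)⁻¹ * ∑ i, X i ω q.1 * X i ω q.2 -
          secondMoment P q.1 q.2|}) := by
        refine measureReal_mono ?_
        rintro ω ⟨j, k, h⟩
        exact Set.mem_iUnion.2 ⟨(j, k), h.le⟩
    _ ≤ ∑ q : Fin p × Fin p, _ := measureReal_iUnion_fintype_le _
    _ ≤ ∑ q : Fin p × Fin p, 2 * Real.exp (-(t ^ 2 / (2 * (K * K) ^ 2) * n)) :=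
        Finset.sum_le_sum fun q _ => hone q
    _ = _ := by
        simp only [Finset.sum_const, Finset.card_univ, Fintype.card_prod, Fintype.card_fin,
          nsmul_eq_mul]
        push_cast
        ring

variable {Q : Measure ℝ} [IsProbabilityMeasure Q] {ε : Fin n → Ω → ℝ}

/-- The noise is almost orthogonal to all predictors. Noise truncated at `T` is treated with
Hoeffding's inequality and a union bound, the remainder with Markov's inequality. -/
lemma measureReal_exists_noise_le [IsProbabilityMeasure P]
    (hX : ∀ i, HasLaw (X i) P μ) (hXi : iIndepFun X μ)
    (hε : ∀ i, HasLaw (ε i) Q μ) (hεi : iIndepFun ε μ)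
    (hXε : IndepFun (fun ω i => X i ω) (fun ω i => ε i ω) μ) {K : ℝ}
    (hK0 : 0 < K) (hK : ∀ j, ∀ᵐ z ∂P, |z j| ≤ K) (hQ : Integrable (fun e : ℝ => e) Q)
    (hmean : ∫ e, e ∂Q = 0) {T t : ℝ} (hT : 0 < T) (ht : 0 < t) (hn : 0 < n)
    (hTt : K * ∫ e, |e - trunc T e| ∂Q ≤ t / 3) :
    μ.real {ω | ∃ j, t < |empInner (fun i => ε i ω) (fun i => X i ω j)|} ≤
      2 * ((p : ℝ) * Real.exp (-((t / 3) ^ 2 / (2 * (T * K) ^ 2) * n))) +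
        3 * K / t * ∫ e, |e - trunc T e| ∂Q := by
  have hn' : (0 : ℝ) < n := by exact_mod_cast hn
  set τ := ∫ e, |e - trunc T e| ∂Q with hτ
  set c : Fin p → ℝ := fun j => (∫ e, trunc T e ∂Q) * ∫ z, z j ∂P with hc
  have hpair := iIndepFun_prodMk_of_indepFun hX hXi hε hεi hXε
  have hmt := measurable_trunc T
  have hone : ∀ j, μ.real {ω | t / 3 ≤ |(n : ℝ)⁻¹ * ∑ i, trunc T (ε i ω) * X i ω j - c j|} ≤
      2 * Real.exp (-((t / 3) ^ 2 / (2 * (T * K) ^ 2) * n)) := by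
    intro j
    have hm1 : ∀ i, AEMeasurable (fun ω => trunc T (ε i ω)) μ := fun i =>
      hmt.comp_aemeasurable (hε i).aemeasurable
    have hm2 : ∀ i, AEMeasurable (fun ω => X i ω j) μ := fun i =>
      (measurable_pi_apply j).comp_aemeasurable (hX i).aemeasurable
    refine measureReal_le_abs_avg_sub_le (Z := fun i ω => trunc T (ε i ω) * X i ω j)
      (hpair.comp (fun _ q => trunc T q.2 * q.1 j) fun _ => by fun_prop)
      (fun i => (hm1 i).mul (hm2 i)) (by positivity) (fun i => ?_) (fun i => ?_)
      (by positivity) hn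
    · filter_upwards [ae_abs_le_of_hasLaw hX hK i j] with ω h1
      rw [abs_mul]
      exact mul_le_mul (abs_trunc_le hT.le _) h1 (abs_nonneg _) hT.le
    · have hind : IndepFun (fun ω => trunc T (ε i ω)) (fun ω => X i ω j) μ :=
        (hXε.comp (φ := fun z : Fin n → Fin p → ℝ => z i j)
          (ψ := fun e : Fin n → ℝ => trunc T (e i)) (by fun_prop) (by fun_prop)).symm
      rw [hind.integral_fun_mul_eq_mul_integral (hm1 i).aestronglyMeasurable
        (hm2 i).aestronglyMeasurable]
      congr 1
      · exact (hε i).integral_comp hmt.aestronglyMeasurable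
      · exact (hX i).integral_comp (measurable_pi_apply j).aestronglyMeasurable
  have htail := integrable_abs_sub_trunc hQ T
  -- the noise is centered, so the truncated noise has mean at most `τ` in absolute value
  have hcK : ∀ j, |c j| ≤ t / 3 := by
    intro j
    have h1 : |∫ e, trunc T e ∂Q| ≤ τ := by
      have h2 : ∫ e, trunc T e ∂Q = -∫ e, (e - trunc T e) ∂Q := by
        rw [integral_sub hQ, hmean]
        · ring
        · exact Integrable.of_bound hmt.aestronglyMeasurable T
            (.of_forall fun e => abs_trunc_le hT.le e)
      rw [h2, abs_neg]
      exact abs_integral_le_integral_abs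
    have h3 : |∫ z, z j ∂P| ≤ K := by
      have := norm_integral_le_of_norm_le_const (μ := P) (f := fun z : Fin p → ℝ => z j) (hK j)
      simpa using this
    rw [hc, abs_mul]
    calc _ ≤ τ * K := mul_le_mul h1 h3 (abs_nonneg _) ((abs_nonneg _).trans h1)
      _ ≤ _ := by linarith
  have hlaw : ∀ i, ∫ ω, |ε i ω - trunc T (ε i ω)| ∂μ = τ := fun i =>
    (hε i).integral_comp (f := fun e => |e - trunc T e|) (by fun_prop)
  have hint : ∀ i, Integrable (fun ω => |ε i ω - trunc T (ε i ω)|) μ := fun i => by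
    have := htail
    rw [← (hε i).map_eq] at this
    exact this.comp_aemeasurable (hε i).aemeasurable
  have hmarkov : μ.real {ω | t / (3 * K) ≤ (n : ℝ)⁻¹ * ∑ i, |ε i ω - trunc T (ε i ω)|} ≤
      3 * K / t * τ := by
    have h1 := mul_meas_ge_le_integral_of_nonneg (μ := μ)
      (f := fun ω => (n : ℝ)⁻¹ * ∑ i, |ε i ω - trunc T (ε i ω)|)
      (.of_forall fun ω => mul_nonneg (by positivity) (Finset.sum_nonneg fun i _ => abs_nonneg _))
      ((integrable_finsetSum _ fun i _ => hint i).const_mul _) (t / (3 * K))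
    rw [integral_const_mul, integral_finsetSum _ fun i _ => hint i] at h1
    simp only [hlaw, Finset.sum_const, Finset.card_univ, Fintype.card_fin, nsmul_eq_mul,
      inv_mul_cancel_left₀ hn'.ne'] at h1
    calc _ = 3 * K / t * (t / (3 * K) *
          μ.real {ω | t / (3 * K) ≤ (n : ℝ)⁻¹ * ∑ i, |ε i ω - trunc T (ε i ω)|}) := by
          field_simp
      _ ≤ _ := by gcongr
  have hbd : ∀ᵐ ω ∂μ, ∀ i j, |X i ω j| ≤ K :=
    ae_all_iff.2 fun i => ae_all_iff.2 fun j => ae_abs_le_of_hasLaw hX hK i j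
  have hsub : {ω | ∃ j, t < |empInner (fun i => ε i ω) (fun i => X i ω j)|} ≤ᵐ[μ]
      ((⋃ j, {ω | t / 3 ≤ |(n : ℝ)⁻¹ * ∑ i, trunc T (ε i ω) * X i ω j - c j|}) ∪
        {ω | t / (3 * K) ≤ (n : ℝ)⁻¹ * ∑ i, |ε i ω - trunc T (ε i ω)|} : Set Ω) := by
    filter_upwards [hbd] with ω hω
    rintro ⟨j, hj⟩
    by_contra hcon
    change ω ∉ (_ ∪ _ : Set Ω) at hcon
    simp only [Set.mem_union, Set.mem_iUnion, Set.mem_ofPred_eq, not_or, not_exists, not_le] at hcon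
    obtain ⟨h1, h2⟩ := hcon
    have h1 := h1 j
    have h3 : empInner (fun i => ε i ω) (fun i => X i ω j) =
        ((n : ℝ)⁻¹ * ∑ i, trunc T (ε i ω) * X i ω j - c j) + c j +
          (n : ℝ)⁻¹ * ∑ i, (ε i ω - trunc T (ε i ω)) * X i ω j := by
      simp only [empInner, sub_mul, Finset.sum_sub_distrib]
      ring
    have h4 : |(n : ℝ)⁻¹ * ∑ i, (ε i ω - trunc T (ε i ω)) * X i ω j| < t / 3 := by
      rw [abs_mul, abs_of_pos (inv_pos.2 hn')]
      calc _ ≤ (n : ℝ)⁻¹ * ∑ i, |ε i ω - trunc T (ε i ω)| * K := by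
            gcongr
            refine (Finset.abs_sum_le_sum_abs _ _).trans (Finset.sum_le_sum fun i _ => ?_)
            rw [abs_mul]
            exact mul_le_mul_of_nonneg_left (hω i j) (abs_nonneg _)
        _ = (n : ℝ)⁻¹ * (∑ i, |ε i ω - trunc T (ε i ω)|) * K := by
            rw [← Finset.sum_mul, mul_assoc]
        _ < t / (3 * K) * K := by gcongr
        _ = t / 3 := by field_simp
    rw [h3] at hj
    have h5 := (abs_add_le (((n : ℝ)⁻¹ * ∑ i, trunc T (ε i ω) * X i ω j - c j) + c j)
      ((n : ℝ)⁻¹ * ∑ i, (ε i ω - trunc T (ε i ω)) * X i ω j)).trans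
      (add_le_add_left (abs_add_le _ _) _)
    linarith [hcK j]
  calc _ ≤ _ := ENNReal.toReal_mono (measure_ne_top _ _) (measure_mono_ae hsub)
    _ ≤ _ := measureReal_union_le _ _
    _ ≤ _ := by
        refine add_le_add ((measureReal_iUnion_fintype_le _).trans
          ((Finset.sum_le_sum fun j _ => hone j).trans (le_of_eq ?_))) hmarkov
        simp only [Finset.sum_const, Finset.card_univ, Fintype.card_fin, nsmul_eq_mul]
        ring

end Design

end Concentration

/-! ### Uniform closeness with high probability -/

lemma tendsto_sq_mul_exp_neg {p : ℕ → ℕ} {ξ C : ℝ} (hξ : 0 < ξ)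
    (hp : (fun n : ℕ => (p n : ℝ)) =O[atTop] fun n : ℕ => Real.exp (C * (n : ℝ) ^ (1 - ξ)))
    {c : ℝ} (hc : 0 < c) :
    Tendsto (fun n : ℕ => (p n : ℝ) ^ 2 * Real.exp (-(c * n))) atTop (𝓝 0) := by
  obtain ⟨D, hD⟩ := hp.bound
  -- the exponent of the bound on `p` is eventually dominated, as `n ^ (1 - ξ) = n / n ^ ξ`
  have hlittle : ∀ᶠ n : ℕ in atTop, 2 * C * (n : ℝ) ^ (1 - ξ) ≤ c / 2 * n := by
    have h := ((tendsto_rpow_atTop hξ).comp tendsto_natCast_atTop_atTop).eventually_ge_atTop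
      (4 * C / c)
    filter_upwards [h, eventually_gt_atTop 0] with n hn hn0
    have hn' : (0 : ℝ) < n := by exact_mod_cast hn0
    have h1 : 4 * C / c ≤ (n : ℝ) ^ ξ := hn
    rw [div_le_iff₀ hc] at h1
    rw [Real.rpow_sub hn', Real.rpow_one, ← mul_div_assoc,
      div_le_iff₀ (Real.rpow_pos_of_pos hn' _)]
    nlinarith
  have hlim : Tendsto (fun n : ℕ => D ^ 2 * Real.exp (-(c / 2 * n))) atTop (𝓝 0) := by
    have h1 : Tendsto (fun n : ℕ => -(c / 2 * (n : ℝ))) atTop atBot :=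
      tendsto_neg_atTop_atBot.comp
        (tendsto_natCast_atTop_atTop.const_mul_atTop (by positivity))
    simpa using (Real.tendsto_exp_atBot.comp h1).const_mul (D ^ 2)
  refine squeeze_zero' (.of_forall fun n => by positivity) ?_ hlim
  filter_upwards [hD, hlittle] with n h1 h3
  rw [Real.norm_eq_abs, Real.norm_eq_abs, abs_of_nonneg (Nat.cast_nonneg _), Real.abs_exp] at h1
  calc (p n : ℝ) ^ 2 * Real.exp (-(c * n))
      ≤ (D * Real.exp (C * (n : ℝ) ^ (1 - ξ))) ^ 2 * Real.exp (-(c * n)) := by gcongr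
    _ = D ^ 2 * Real.exp (2 * C * (n : ℝ) ^ (1 - ξ) + -(c * n)) := by
        rw [Real.exp_add, mul_pow, ← Real.exp_nat_mul]
        push_cast
        ring_nf
    _ ≤ D ^ 2 * Real.exp (-(c / 2 * n)) := by
        gcongr
        linarith

/-- A diagonal argument: if every `f k` tends to zero, then so does `n ↦ f (r n) n` along a
sequence `r` that tends to infinity slowly enough. -/
lemma exists_tendsto_diagonal {f : ℕ → ℕ → ENNReal} (hf : ∀ k, Tendsto (f k) atTop (𝓝 0)) :
    ∃ r : ℕ → ℕ, Tendsto r atTop atTop ∧ Tendsto (fun n => f (r n) n) atTop (𝓝 0) := by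
  classical
  let r : ℕ → ℕ := fun n => Nat.findGreatest (fun k => f k n ≤ (k : ENNReal)⁻¹) n
  have hr : Tendsto r atTop atTop := by
    refine tendsto_atTop.2 fun k => ?_
    filter_upwards [eventually_ge_atTop k,
      (hf k).eventually (eventually_le_nhds (b := (k : ENNReal)⁻¹) (by simp))] with n h1 h2
    exact Nat.le_findGreatest h1 h2
  refine ⟨r, hr, tendsto_of_tendsto_of_tendsto_of_le_of_le tendsto_const_nhds
    (ENNReal.tendsto_inv_nat_nhds_zero.comp hr) (fun n => zero_le) fun n => ?_⟩
  -- `k = 0` always satisfies the defining property of `r n`, since its bound is `∞`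
  exact Nat.findGreatest_spec (P := fun k => f k n ≤ (k : ENNReal)⁻¹) (Nat.zero_le n) (by simp)

/-- With probability tending to one, all empirical second moments and all correlations between
noise and predictors are uniformly close to their population values. -/
lemma tendsto_measure_not_close {Ω : Type*} [MeasurableSpace Ω] {μ : Measure Ω}
    [IsProbabilityMeasure μ] {p : ℕ → ℕ} (hp : ∀ n, 1 ≤ p n)
    {P : (n : ℕ) → Measure (Fin (p n) → ℝ)} [∀ n, IsProbabilityMeasure (P n)] {Q : Measure ℝ}
    [IsProbabilityMeasure Q] {X : (n : ℕ) → Fin n → Ω → Fin (p n) → ℝ}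
    {ε : (n : ℕ) → Fin n → Ω → ℝ} (hX : ∀ n i, HasLaw (X n i) (P n) μ)
    (hXi : ∀ n, iIndepFun (X n) μ) (hε : ∀ n i, HasLaw (ε n i) Q μ)
    (hεi : ∀ n, iIndepFun (ε n) μ)
    (hXε : ∀ n, IndepFun (fun ω i => X n i ω) (fun ω i => ε n i ω) μ)
    (hQ : Integrable (fun e : ℝ => e) Q) (hmean : ∫ e, e ∂Q = 0) {K : ℝ} (hK0 : 0 < K)
    (hK : ∀ n j, ∀ᵐ z ∂(P n), |z j| ≤ K)
    (hgrowth : ∀ c : ℝ, 0 < c →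
      Tendsto (fun n : ℕ => (p n : ℝ) ^ 2 * Real.exp (-(c * n))) atTop (𝓝 0))
    {t : ℝ} (ht : 0 < t) :
    Tendsto (fun n => μ {ω | ¬ Close (secondMoment (P n)) (fun i => X n i ω) (fun i => ε n i ω) t})
      atTop (𝓝 0) := by
  rw [← ENNReal.tendsto_toReal_iff (fun n => measure_ne_top _ _) ENNReal.zero_ne_top,
    ENNReal.toReal_zero]
  refine tendsto_order.2 ⟨fun b hb => .of_forall fun n => hb.trans_le ENNReal.toReal_nonneg,
    fun b hb => ?_⟩
  have htrunc := tendsto_integral_abs_sub_trunc hQ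
  have hlim : ∀ c : ℝ,
      Tendsto (fun T : ℕ => c * ∫ e, |e - trunc T e| ∂Q) atTop (𝓝 0) := fun c => by
    simpa using htrunc.const_mul c
  have hT1 := (hlim K).eventually (eventually_lt_nhds (b := t / 3) (by positivity))
  have hT2 := (hlim (3 * K / t)).eventually (eventually_lt_nhds (b := b / 3) (by linarith))
  obtain ⟨T, hT1, hT2, hT0⟩ := (hT1.and (hT2.and (eventually_gt_atTop 0))).exists
  have hT0' : (0 : ℝ) < T := by exact_mod_cast hT0
  have hg1 := ((hgrowth (t ^ 2 / (2 * (K * K) ^ 2)) (by positivity)).const_mul 2).eventually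
    (eventually_lt_nhds (b := b / 3) (by simpa using hb))
  have hg2 := ((hgrowth ((t / 3) ^ 2 / (2 * (T * K) ^ 2)) (by positivity)).const_mul 2).eventually
    (eventually_lt_nhds (b := b / 3) (by simpa using hb))
  filter_upwards [hg1, hg2, eventually_gt_atTop 0] with n h1 h2 hn
  have hA := measureReal_exists_gram_le (hX n) (hXi n) hK0 (hK n) ht.le hn
  have hB := measureReal_exists_noise_le (hX n) (hXi n) (hε n) (hεi n) (hXε n) hK0 (hK n) hQ hmean
    hT0' ht hn hT1.le
  have hpp : (p n : ℝ) ≤ (p n : ℝ) ^ 2 := by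
    have : (1 : ℝ) ≤ p n := by exact_mod_cast hp n
    nlinarith
  have hB' : 2 * ((p n : ℝ) * Real.exp (-((t / 3) ^ 2 / (2 * (T * K) ^ 2) * n))) < b / 3 :=
    lt_of_le_of_lt (by gcongr) h2
  have hsub : {ω | ¬ Close (secondMoment (P n)) (fun i => X n i ω) (fun i => ε n i ω) t} ⊆
      {ω | ∃ j k, t < |empInner (fun i => X n i ω j) (fun i => X n i ω k) -
        secondMoment (P n) j k|} ∪
      {ω | ∃ j, t < |empInner (fun i => ε n i ω) (fun i => X n i ω j)|} := by
    intro ω hω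
    by_contra hcon
    simp only [Set.mem_union, Set.mem_ofPred_eq, not_or, not_exists, not_lt] at hcon hω
    exact hω ⟨hcon.1, hcon.2⟩
  calc _ ≤ _ := measureReal_mono hsub
    _ ≤ _ := measureReal_union_le _ _
    _ < b := by linarith

lemma integrable_of_integrable_abs_rpow {Q : Measure ℝ} [IsFiniteMeasure Q] {δ : ℝ} (hδ : 1 ≤ δ)
    (h : Integrable (fun e : ℝ => |e| ^ δ) Q) : Integrable (fun e : ℝ => e) Q := by
  refine ((integrable_const (1 : ℝ)).add h).mono (by fun_prop) (.of_forall fun e => ?_)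
  have h0 : 0 ≤ |e| ^ δ := by positivity
  rw [Pi.add_apply, Real.norm_eq_abs, Real.norm_eq_abs,
    abs_of_nonneg (a := 1 + |e| ^ δ) (by positivity)]
  rcases le_total |e| 1 with h1 | h1
  · linarith
  · have := Real.rpow_le_rpow_of_exponent_le h1 hδ
    rw [Real.rpow_one] at this
    linarith

end SingBoost

/-! ### Estimation consistency -/

theorem theorem6p1 {Ω : Type*} [MeasurableSpace Ω] (μ : Measure Ω) [IsProbabilityMeasure μ]
    -- number of predictors and true coefficients for sample size `n`
    (p : ℕ → ℕ) (hp : ∀ n, 1 ≤ p n) (β : (n : ℕ) → Fin (p n) → ℝ)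
    -- law of one predictor vector for sample size `n`, and law of one error
    (P : (n : ℕ) → Measure (Fin (p n) → ℝ)) [∀ n, IsProbabilityMeasure (P n)]
    (Q : Measure ℝ) [IsProbabilityMeasure Q]
    -- the data for sample size `n`
    (X : (n : ℕ) → Fin n → Ω → Fin (p n) → ℝ) (ε Y : (n : ℕ) → Fin n → Ω → ℝ)
    (hXlaw : ∀ n i, HasLaw (X n i) (P n) μ)
    (hXindep : ∀ n, iIndepFun (X n) μ)
    (hεlaw : ∀ n i, HasLaw (ε n i) Q μ)
    (hεindep : ∀ n, iIndepFun (ε n) μ)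
    (hXε : ∀ n, IndepFun (fun ω i => X n i ω) (fun ω i => ε n i ω) μ)
    (hY : ∀ n i ω, Y n i ω = SingBoost.linPred (β n) (X n i ω) + ε n i ω)
    (hXsq : ∀ n j, ∫ z, (z j) ^ 2 ∂(P n) = 1)
    (hεmean : ∫ e, e ∂Q = 0)
    -- (E1)
    (ξ : ℝ) (hξ0 : 0 < ξ) (hξ1 : ξ < 1) (C : ℝ) (hC : 0 < C)
    (hE1 : (fun n : ℕ => (p n : ℝ)) =O[atTop] fun n : ℕ => Real.exp (C * (n : ℝ) ^ (1 - ξ)))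
    -- (E2)
    (hE2 : ∃ B : ℝ, ∀ n, ∑ j, |β n j| ≤ B)
    -- (E3)
    (hE3 : ∃ K : ℝ, ∀ n j, ∀ᵐ z ∂(P n), |z j| ≤ K)
    -- (E4)
    (δ : ℝ) (hδ : 4 / ξ < δ) (hE4 : Integrable (fun e : ℝ => |e| ^ δ) Q)
    -- step size and Corr-min constant
    (κ : ℝ) (hκ0 : 0 < κ) (hκ1 : κ ≤ 1) (a : ℝ) (ha : 0 < a) :
    ∃ r : ℕ → ℕ, Tendsto r atTop atTop ∧
      -- every SingBoost procedure, with target losses `L n` and singular iterations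
      -- `1, M n + 1, 2 * M n + 1, …`, that satisfies (E5)
      ∀ (L : (n : ℕ) → (Fin n → ℝ) → (Fin n → ℝ) → ℝ) (M : ℕ → ℕ)
        (sel : (n : ℕ) → Ω → ℕ → Fin (p n)),
        (∀ n, 1 ≤ M n) →
        (∀ᵐ ω ∂μ, ∀ n, SingBoost.IsSelection κ (L n) (M n)
          (fun i => X n i ω) (fun i => Y n i ω) (sel n ω)) →
        (∀ᵐ ω ∂μ, ∀ n, SingBoost.CorrMin κ a
          (fun i => X n i ω) (fun i => Y n i ω) (sel n ω)) →
        -- every sequence of iteration numbers that tends to infinity at most as fast as `r`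
        ∀ m : ℕ → ℕ, Tendsto m atTop atTop → (∀ᶠ n in atTop, m n ≤ r n) →
          TendstoInMeasure μ
            (fun n ω => ∫ z,
              (SingBoost.model κ (fun i => X n i ω) (fun i => Y n i ω) (sel n ω) (m n) z -
                SingBoost.linPred (β n) z) ^ 2 ∂(P n))
            atTop (fun _ => 0) := by
  obtain ⟨B, hB⟩ := hE2
  obtain ⟨K₀, hK₀⟩ := hE3
  have hK : ∀ n j, ∀ᵐ z ∂(P n), |z j| ≤ max K₀ 1 := fun n j =>
    (hK₀ n j).mono fun z hz => hz.trans (le_max_left _ _)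
  have hK0 : 0 < max K₀ 1 := lt_max_of_lt_right one_pos
  have hB0 : 0 ≤ B := (Finset.sum_nonneg fun j _ => abs_nonneg (β 0 j)).trans (hB 0)
  have hδ1 : 1 ≤ δ := by
    have : 4 ≤ 4 / ξ := by rw [le_div_iff₀ hξ0]; linarith
    linarith
  have hclose := fun k : ℕ => SingBoost.tendsto_measure_not_close hp hXlaw hXindep hεlaw hεindep hXε
    (SingBoost.integrable_of_integrable_abs_rpow hδ1 hE4) hεmean hK0 hK
    (fun c hc => SingBoost.tendsto_sq_mul_exp_neg hξ0 hE1 hc) (SingBoost.tolerance_pos hB0 k)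
  -- `r` is chosen from the deviation probabilities of the data, before any procedure is fixed
  obtain ⟨r, hr, hlim⟩ := SingBoost.exists_tendsto_diagonal hclose
  refine ⟨r, hr, fun L M sel _ _ hcm m hm hmr => ?_⟩
  refine tendstoInMeasure_of_ne_top fun η hη hη' => ?_
  have hrate := ((SingBoost.tendsto_rate κ a B).comp hm).eventually
    (eventually_lt_nhds (ENNReal.toReal_pos hη.ne' hη'))
  refine tendsto_of_tendsto_of_tendsto_of_le_of_le' tendsto_const_nhds hlim
    (.of_forall fun n => zero_le) ?_
  filter_upwards [hmr, hrate, hm.eventually_ge_atTop 1] with n h1 h2 h3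
  have hsub : ∀ᵐ ω ∂μ, η ≤ edist (∫ z,
        (SingBoost.model κ (fun i => X n i ω) (fun i => Y n i ω) (sel n ω) (m n) z -
          SingBoost.linPred (β n) z) ^ 2 ∂(P n)) 0 →
      ¬ SingBoost.Close (SingBoost.secondMoment (P n)) (fun i => X n i ω) (fun i => ε n i ω)
        (SingBoost.tolerance B (r n)) := by
    filter_upwards [hcm] with ω hω hdist hcl
    have hdiag : ∀ j, SingBoost.secondMoment (P n) j j = 1 := fun j => by
      simpa [SingBoost.secondMoment, sq] using hXsq n j
    have hpos : ∀ θ, 0 ≤ SingBoost.quadForm (SingBoost.secondMoment (P n)) θ := fun θ => by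
      rw [← SingBoost.integral_linPred_sq (hK n)]
      exact integral_nonneg fun z => sq_nonneg _
    have hle := (hcl.mono (SingBoost.tolerance_antitone hB0 h1)).quadForm_le_rate
      (SingBoost.secondMoment_comm (P n)) hdiag
      (SingBoost.abs_secondMoment_le_one (hK n) (hXsq n)) hpos (fun i => hY n i ω) (hB n) hκ0 hκ1
      ha (hω n) h3
    have hint : ∫ z, (SingBoost.model κ (fun i => X n i ω) (fun i => Y n i ω) (sel n ω) (m n) z -
        SingBoost.linPred (β n) z) ^ 2 ∂(P n) =
        SingBoost.quadForm (SingBoost.secondMoment (P n))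
          (β n - SingBoost.coef κ (fun i => X n i ω) (fun i => Y n i ω) (sel n ω) (m n)) := by
      rw [← SingBoost.integral_linPred_sq (hK n)]
      refine integral_congr_ae (.of_forall fun z => ?_)
      simp only [SingBoost.model_eq_linPred, SingBoost.linPred_sub]
      ring
    rw [hint, edist_dist, Real.dist_eq, sub_zero, abs_of_nonneg (hpos _),
      ENNReal.le_ofReal_iff_toReal_le hη' (hpos _)] at hdist
    exact absurd h2 (not_lt.2 (hdist.trans hle))
  exact measure_mono_ae hsub
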